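/- Let $K$ be a field, $A=K[x_1,\ldots,x_n]$, $B=K[y_1,\ldots,y_m]$ and $S=A\otimes_K B=K[x_1,\ldots,x_n,y_1,\ldots,y_m]$, all with the standard grading. For ideals $I\subset A$ and $J\subset B$ write $I+J:=IS+JS\subset S$ and $IJ:=(IS)(JS)\subset S$. For an ideal $L$ of a polynomial ring $R$ over $K$, let $\overline{L}$ be its integral closure, i.e. the ideal of all $f\in R$ satisfying an equation $f^t+r_1f^{t-1}+\cdots+r_t=0$ with $t\ge 1$ and $r_i\in L^i$; let $\mathrm{Ass}(L)$ be the set of associated primes of $R/L$; and for a prime $P$ of $R$ let $$\mathrm{v}_P(L)=\min\{d\ge 0 \mid \exists f\in R_d \text{ with } L:f=P\}$$ be the local $\mathrm{v}$-number of $L$ at $P$ (with $\mathrm{v}_P(L)=\infty$ if there is no such $f$). An ideal is monomial if it is generated by monomials. Let $I\subset A$ and $J\subset B$ be nonzero monomial ideals and let $k\ge 0$ be an integer such that $$\overline{(I+J)^k}=\sum_{i+j=k}\overline{I^i}\;\overline{J^j}.$$ Let $\mathfrak p\subset A$ and $\mathfrak q\subset B$ be prime ideals that are monomial ideals, with $\mathfrak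 p+\mathfrak q\in\mathrm{Ass}(\overline{(I+J)^k})$. Then $\mathrm{v}_{\mathfrak p+\mathfrak q}(\overline{(I+J)^k})$ is finite and $$\mathrm{v}_{\mathfrak p+\mathfrak q}\bigl(\overline{(I+J)^k}\bigr)=\min_{\substack{0\le d<k\\ \mathfrak p\in\mathrm{Ass}(\overline{I^{k-d}})\\ \mathfrak q\in\mathrm{Ass}(\overline{J^{d+1}})}}\Bigl(\mathrm{v}_{\mathfrak p}(\overline{I^{k-d}})+\mathrm{v}_{\mathfrak q}(\overline{J^{d+1}})\Bigr),$$ where in particular the set of indices $d$ over which the minimum is taken is nonempty. -/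

import Mathlib

open MvPolynomial

/-- `f` is integral over the ideal `I`: `f ^ n + r₁ f ^ (n - 1) + ⋯ + rₙ = 0` for some `n ≥ 1` and
elements `rᵢ ∈ I ^ i`. -/
def IsIntegralOverIdeal {R : Type*} [CommRing R] (I : Ideal R) (f : R) : Prop :=
  ∃ n : ℕ, 0 < n ∧ ∃ r : ℕ → R, (∀ i ∈ Finset.Icc 1 n, r i ∈ I ^ i) ∧
    f ^ n + ∑ i ∈ Finset.Icc 1 n, r i * f ^ (n - i) = 0

/-- Integrality of `f` over `I` is integrality of `f t` over the Rees algebra `R[It] ⊆ R[t]`. -/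
theorem isIntegralOverIdeal_iff {R : Type*} [CommRing R] (I : Ideal R) (f : R) :
    IsIntegralOverIdeal I f ↔
      IsIntegral (Algebra.adjoin R {x | ∃ r ∈ I, Polynomial.C r * Polynomial.X = x})
        (Polynomial.C f * Polynomial.X) := by
  constructor
  · rintro ⟨n, hn, r, hr, e⟩
    have hadj : ∀ i ∈ Finset.Icc 1 n, Polynomial.monomial i (r i) ∈
        Algebra.adjoin R {x | ∃ r ∈ I, Polynomial.C r * Polynomial.X = x} := by
      intro i hi
      have h := monomial_mem_adjoin_monomial (hr i hi)
      refine Algebra.adjoin_mono ?_ h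
      rintro _ ⟨a, ha, rfl⟩
      exact ⟨a, ha, by simp [Polynomial.C_mul_X_eq_monomial]⟩
    set A := Algebra.adjoin R {x | ∃ r ∈ I, Polynomial.C r * Polynomial.X = x}
    have key : ∀ i ∈ Finset.Icc 1 n, ∃ a : A, (a : Polynomial R) = Polynomial.monomial i (r i) :=
      fun i hi => ⟨⟨_, hadj i hi⟩, rfl⟩
    choose! a ha using key
    refine ⟨Polynomial.X ^ n +
      ∑ i ∈ Finset.Icc 1 n, Polynomial.C (a i) * Polynomial.X ^ (n - i), ?_, ?_⟩
    · refine Polynomial.monic_X_pow_add ?_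
      refine lt_of_le_of_lt (Polynomial.degree_sum_le _ _) ?_
      refine (Finset.sup_lt_iff (WithBot.bot_lt_coe n)).2 ?_
      intro i hi
      rw [Finset.mem_Icc] at hi
      refine lt_of_le_of_lt (Polynomial.degree_C_mul_X_pow_le _ _) ?_
      exact Nat.cast_lt.2 (by omega)
    · simp only [Polynomial.eval₂_add, Polynomial.eval₂_pow, Polynomial.eval₂_X,
        Polynomial.eval₂_finsetSum, Polynomial.eval₂_mul, Polynomial.eval₂_C]
      have h2 : ∀ i ∈ Finset.Icc 1 n, algebraMap A (Polynomial R) (a i) *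
          (Polynomial.C f * Polynomial.X) ^ (n - i) =
            Polynomial.C (r i * f ^ (n - i)) * Polynomial.X ^ n := by
        intro i hi
        have h3 : algebraMap A (Polynomial R) (a i) = _ := ha i hi
        rw [Finset.mem_Icc] at hi
        rw [h3, ← Polynomial.C_mul_X_pow_eq_monomial]
        obtain ⟨m, rfl⟩ := Nat.exists_eq_add_of_le hi.2
        simp only [Nat.add_sub_cancel_left, map_mul, map_pow]
        ring
      rw [Finset.sum_congr rfl h2, ← Finset.sum_mul, ← map_sum, mul_pow, ← map_pow, ← add_mul,
        ← map_add, e]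
      simp
  · intro h
    rcases subsingleton_or_nontrivial R with hR | hR
    · exact ⟨1, one_pos, fun _ => 0, fun _ _ => Ideal.zero_mem _, Subsingleton.elim _ _⟩
    have hinst : (Polynomial.algebra R R : Algebra (Polynomial R) (Polynomial R)) =
        Algebra.id (Polynomial R) := by
      apply Algebra.algebra_ext
      intro x
      exact Polynomial.map_id
    obtain ⟨p, hp, e, hc⟩ :=
      Polynomial.exists_monic_aeval_eq_zero_forall_mem_pow_of_isIntegral
        (R := R) (S := R) (I := I) (x := f) (by rw [hinst]; exact h)
    have hd : 0 < p.natDegree := by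
      rw [Nat.pos_iff_ne_zero]
      intro h0
      rw [hp.natDegree_eq_zero] at h0
      simp [h0] at e
    refine ⟨p.natDegree, hd, fun i => p.coeff (p.natDegree - i), ?_, ?_⟩
    · intro i hi
      rw [Finset.mem_Icc] at hi
      have := hc (p.natDegree - i)
      rwa [Nat.sub_sub_self hi.2] at this
    · rw [Polynomial.aeval_eq_sum_range, Finset.sum_range_succ, Polynomial.coeff_natDegree,
        hp.leadingCoeff, one_smul, add_comm] at e
      rw [← e]
      congr 1
      refine Finset.sum_nbij' (fun i => p.natDegree - i) (fun i => p.natDegree - i) ?_ ?_ ?_ ?_ ?_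
      all_goals
        intro i hi
        simp only [Finset.mem_Icc, Finset.mem_range, smul_eq_mul] at *
        try omega

/-- The integral closure of an ideal `I` of `R`: the set of all elements integral over `I`. -/
def Ideal.intClosure {R : Type*} [CommRing R] (I : Ideal R) : Ideal R where
  carrier := {f | IsIntegralOverIdeal I f}
  add_mem' := by
    intro a b ha hb
    simp only [Set.mem_ofPred_eq, isIntegralOverIdeal_iff] at *
    simpa [add_mul] using ha.add hb
  zero_mem' := by
    simp only [Set.mem_ofPred_eq, isIntegralOverIdeal_iff]
    simpa using isIntegral_zero
  smul_mem' := by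
    rintro c f ⟨n, hn, r, hr, e⟩
    refine ⟨n, hn, fun i => c ^ i * r i, fun i hi => Ideal.mul_mem_left _ _ (hr i hi), ?_⟩
    have h2 : ∀ i ∈ Finset.Icc 1 n, c ^ i * r i * (c • f) ^ (n - i) =
        c ^ n * (r i * f ^ (n - i)) := by
      intro i hi
      rw [Finset.mem_Icc] at hi
      obtain ⟨m, rfl⟩ := Nat.exists_eq_add_of_le hi.2
      simp only [Nat.add_sub_cancel_left, smul_eq_mul]
      ring
    rw [Finset.sum_congr rfl h2, ← Finset.mul_sum, smul_eq_mul, mul_pow, ← mul_add, e, mul_zero]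

/-- An ideal of a polynomial ring is a monomial ideal if it is generated by monomials. -/
def IsMonomialIdeal {σ K : Type*} [Field K] (L : Ideal (MvPolynomial σ K)) : Prop :=
  ∃ T : Set (σ →₀ ℕ), L = Ideal.span ((fun c => monomial c (1 : K)) '' T)

/-- The local `v`-number `v_P(L)`: the least degree of a homogeneous `f` with `L : f = P`
(`⊤` if there is no such `f`). -/
noncomputable def localVNumber {σ K : Type*} [Field K] (L P : Ideal (MvPolynomial σ K)) : ℕ∞ :=
  ⨅ (d : ℕ) (_ : ∃ f : MvPolynomial σ K, f.IsHomogeneous d ∧ L.colon {f} = P), (d : ℕ∞)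

/-- The extension to `K[x₁, …, xₙ, y₁, …, yₘ]` of an ideal of `K[x₁, …, xₙ]`. -/
noncomputable def extendLeft {K : Type*} [Field K] {n : ℕ} (m : ℕ)
    (I : Ideal (MvPolynomial (Fin n) K)) : Ideal (MvPolynomial (Fin n ⊕ Fin m) K) :=
  I.map (rename Sum.inl : MvPolynomial (Fin n) K →ₐ[K] MvPolynomial (Fin n ⊕ Fin m) K)

/-- The extension to `K[x₁, …, xₙ, y₁, …, yₘ]` of an ideal of `K[y₁, …, yₘ]`. -/
noncomputable def extendRight {K : Type*} [Field K] (n : ℕ) {m : ℕ}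
    (J : Ideal (MvPolynomial (Fin m) K)) : Ideal (MvPolynomial (Fin n ⊕ Fin m) K) :=
  J.map (rename Sum.inr : MvPolynomial (Fin m) K →ₐ[K] MvPolynomial (Fin n ⊕ Fin m) K)

/-! ### Monomial ideals, read off from the exponents of their monomials -/

section MonomialIdeal

variable {σ K : Type*} [Field K]

/-! All ideals involved are monomial, so the theorem is about exponents. Let E_i and F_j be the
exponent sets of the integral closures of I^i and J^j. By the binomial hypothesis, x^a y^b lies in
L, the closure of (I+J)^k, iff a ∈ E_i and b ∈ F_j for some i + j = k. Both filtrations decrease,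
and removing one variable costs at most one step: a + e_s ∈ E_{i+1} implies a ∈ E_i
(`monomial_mem_intClosure_pow_of_add_single`).

Suppose L : x^a y^b = p + q, and let d ≤ k be maximal with b ∈ F_d. Then x^(a+c) y^b ∈ L iff a + c ∈
E_{k-d}, so p is the colon of the closure of I^(k-d) by x^a. A variable in p or q forces a ∈
E_{k-d-1}, hence q is the colon of the closure of J^(d+1) by y^b (`exists_index_of_sum_colon`).
Conversely, two such colons combine to p + q (`sum_colon_of_index`).

At monomial primes the v-number is attained by a monomial (`exists_localVNumber_eq`), and degrees
add, which gives the formula. -/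

theorem monomial_mem_span_iff {T : Set (σ →₀ ℕ)} {a : σ →₀ ℕ} :
    monomial a (1 : K) ∈ Ideal.span ((fun c => monomial c (1 : K)) '' T) ↔ ∃ t ∈ T, t ≤ a := by
  classical
  rw [mem_ideal_span_monomial_image]
  rw [support_monomial, if_neg one_ne_zero]
  simp only [Finset.mem_singleton, forall_eq]

theorem IsMonomialIdeal.mem_iff {L : Ideal (MvPolynomial σ K)} (hL : IsMonomialIdeal L)
    {f : MvPolynomial σ K} : f ∈ L ↔ ∀ a ∈ f.support, monomial a (1 : K) ∈ L := by
  obtain ⟨T, rfl⟩ := hL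
  rw [mem_ideal_span_monomial_image]
  simp only [monomial_mem_span_iff]

theorem isMonomialIdeal_of_forall {L : Ideal (MvPolynomial σ K)}
    (h : ∀ f ∈ L, ∀ a ∈ f.support, monomial a (1 : K) ∈ L) : IsMonomialIdeal L := by
  refine ⟨{a | monomial a (1 : K) ∈ L}, le_antisymm (fun f hf => ?_) ?_⟩
  · rw [mem_ideal_span_monomial_image]
    exact fun a ha => ⟨a, h f hf a ha, le_rfl⟩
  · rw [Ideal.span_le]
    rintro _ ⟨a, ha, rfl⟩
    exact ha

theorem monomial_mem_of_le {L : Ideal (MvPolynomial σ K)} {a b : σ →₀ ℕ} (hab : a ≤ b)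
    (ha : monomial a (1 : K) ∈ L) : monomial b (1 : K) ∈ L := by
  obtain ⟨c, rfl⟩ := exists_add_of_le hab
  have := L.mul_mem_right (monomial c (1 : K)) ha
  rwa [monomial_mul, mul_one] at this

theorem IsMonomialIdeal.ext {L M : Ideal (MvPolynomial σ K)} (hL : IsMonomialIdeal L)
    (hM : IsMonomialIdeal M) (h : ∀ a, monomial a (1 : K) ∈ L ↔ monomial a (1 : K) ∈ M) :
    L = M := by
  ext f
  rw [hL.mem_iff, hM.mem_iff]
  exact forall₂_congr fun a _ => h a

theorem isMonomialIdeal_top : IsMonomialIdeal (⊤ : Ideal (MvPolynomial σ K)) :=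
  isMonomialIdeal_of_forall fun _ _ _ _ => Submodule.mem_top

theorem isMonomialIdeal_bot : IsMonomialIdeal (⊥ : Ideal (MvPolynomial σ K)) :=
  ⟨∅, by simp⟩

theorem IsMonomialIdeal.mul_and {L M : Ideal (MvPolynomial σ K)} (hL : IsMonomialIdeal L)
    (hM : IsMonomialIdeal M) : IsMonomialIdeal (L * M) ∧
    ∀ a, monomial a (1 : K) ∈ L * M ↔
      ∃ b c, b + c = a ∧ monomial b (1 : K) ∈ L ∧ monomial c (1 : K) ∈ M := by
  obtain ⟨T, rfl⟩ := hL
  obtain ⟨U, rfl⟩ := hM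
  have h : Ideal.span ((fun c => monomial c (1 : K)) '' T) *
      Ideal.span ((fun c => monomial c (1 : K)) '' U) =
        Ideal.span ((fun c => monomial c (1 : K)) '' (Set.image2 (· + ·) T U)) := by
    rw [Ideal.span_mul_span']
    congr 1
    ext f
    simp only [Set.mem_mul, Set.mem_image, Set.mem_image2]
    constructor
    · rintro ⟨_, ⟨a, ha, rfl⟩, _, ⟨b, hb, rfl⟩, rfl⟩
      exact ⟨_, ⟨a, ha, b, hb, rfl⟩, by simp [monomial_mul]⟩
    · rintro ⟨_, ⟨a, ha, b, hb, rfl⟩, rfl⟩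
      exact ⟨_, ⟨a, ha, rfl⟩, _, ⟨b, hb, rfl⟩, by simp [monomial_mul]⟩
  refine ⟨⟨_, h⟩, fun a => ⟨fun ha => ?_, ?_⟩⟩
  · rw [h, monomial_mem_span_iff] at ha
    obtain ⟨_, ⟨t, ht, u, hu, rfl⟩, hle⟩ := ha
    obtain ⟨e, rfl⟩ := exists_add_of_le hle
    -- The surplus e goes into the second factor, so the factorization of a is exact.
    exact ⟨t, u + e, by simp [add_assoc], monomial_mem_span_iff.2 ⟨t, ht, le_rfl⟩,
      monomial_mem_span_iff.2 ⟨u, hu, by simp⟩⟩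
  · rintro ⟨b, c, rfl, hb, hc⟩
    simpa [monomial_mul] using Ideal.mul_mem_mul hb hc

theorem IsMonomialIdeal.mul {L M : Ideal (MvPolynomial σ K)} (hL : IsMonomialIdeal L)
    (hM : IsMonomialIdeal M) : IsMonomialIdeal (L * M) := (hL.mul_and hM).1

theorem IsMonomialIdeal.monomial_mem_mul_iff {L M : Ideal (MvPolynomial σ K)}
    (hL : IsMonomialIdeal L) (hM : IsMonomialIdeal M) {a : σ →₀ ℕ} :
    monomial a (1 : K) ∈ L * M ↔
      ∃ b c, b + c = a ∧ monomial b (1 : K) ∈ L ∧ monomial c (1 : K) ∈ M :=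
  (hL.mul_and hM).2 a

theorem IsMonomialIdeal.pow {L : Ideal (MvPolynomial σ K)} (hL : IsMonomialIdeal L) (i : ℕ) :
    IsMonomialIdeal (L ^ i) := by
  induction i with
  | zero => simpa using isMonomialIdeal_top
  | succ i ih => simpa [pow_succ] using ih.mul hL

theorem IsMonomialIdeal.sup_and {L M : Ideal (MvPolynomial σ K)} (hL : IsMonomialIdeal L)
    (hM : IsMonomialIdeal M) : IsMonomialIdeal (L + M) ∧
    ∀ a, monomial a (1 : K) ∈ L + M ↔ monomial a (1 : K) ∈ L ∨ monomial a (1 : K) ∈ M := by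
  obtain ⟨T, rfl⟩ := hL
  obtain ⟨U, rfl⟩ := hM
  have h : Ideal.span ((fun c => monomial c (1 : K)) '' T) +
      Ideal.span ((fun c => monomial c (1 : K)) '' U) =
        Ideal.span ((fun c => monomial c (1 : K)) '' (T ∪ U)) := by
    rw [Set.image_union, Ideal.span_union, Submodule.add_eq_sup]
  refine ⟨⟨_, h⟩, fun a => ?_⟩
  rw [h]
  simp only [monomial_mem_span_iff, Set.mem_union, or_and_right, exists_or]

theorem IsMonomialIdeal.sum_and {ι : Type*} (s : Finset ι) (L : ι → Ideal (MvPolynomial σ K))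
    (hL : ∀ i ∈ s, IsMonomialIdeal (L i)) : IsMonomialIdeal (∑ i ∈ s, L i) ∧
    ∀ a, monomial a (1 : K) ∈ ∑ i ∈ s, L i ↔ ∃ i ∈ s, monomial a (1 : K) ∈ L i := by
  classical
  induction s using Finset.induction_on with
  | empty => exact ⟨by simpa using isMonomialIdeal_bot, by simp⟩
  | insert i s hi ih =>
    have ih := ih fun j hj => hL j (Finset.mem_insert_of_mem hj)
    have h := (hL i (Finset.mem_insert_self _ _)).sup_and ih.1
    rw [Finset.sum_insert hi]
    refine ⟨h.1, fun a => ?_⟩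
    rw [h.2, ih.2]
    simp

/-- If `I` is a monomial ideal then `I ^ (N + 1) : x ⊆ I ^ N` for each variable `x`. -/
theorem IsMonomialIdeal.monomial_mem_pow_of_add_single {I : Ideal (MvPolynomial σ K)}
    (hI : IsMonomialIdeal I) (s : σ) (N : ℕ) (a : σ →₀ ℕ)
    (h : monomial (a + Finsupp.single s 1) (1 : K) ∈ I ^ (N + 1)) :
    monomial a (1 : K) ∈ I ^ N := by
  induction N generalizing a with
  | zero => simp
  | succ N ih =>
    rw [pow_succ, (hI.pow _).monomial_mem_mul_iff hI] at h
    obtain ⟨b, c, e, hb, hc⟩ := h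
    -- If x_s does not divide x^b, then b ≤ a and x^b is already in the required power; otherwise
    -- x_s is cancelled from x^b, by induction.
    by_cases hs : b s = 0
    · refine monomial_mem_of_le (fun t => ?_) hb
      have := DFunLike.congr_fun e t
      rw [Finsupp.add_apply, Finsupp.add_apply] at this
      by_cases hst : s = t
      · subst hst; omega
      · rw [Finsupp.single_eq_of_ne' hst] at this
        omega
    · have hle : Finsupp.single s 1 ≤ b := by
        rw [Finsupp.single_le_iff]; omega
      obtain ⟨b, rfl⟩ := exists_add_of_le hle
      rw [add_comm (Finsupp.single s 1)] at hb
      rw [pow_succ, (hI.pow _).monomial_mem_mul_iff hI]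
      refine ⟨b, c, ?_, ih b hb, hc⟩
      rw [add_assoc, add_comm (Finsupp.single s 1)] at e
      exact add_right_cancel e

theorem IsMonomialIdeal.monomial_mem_pow_of_add_nsmul_single {I : Ideal (MvPolynomial σ K)}
    (hI : IsMonomialIdeal I) (s : σ) (N r : ℕ) (a : σ →₀ ℕ)
    (h : monomial (a + r • Finsupp.single s 1) (1 : K) ∈ I ^ (N + r)) :
    monomial a (1 : K) ∈ I ^ N := by
  induction r with
  | zero => simpa using h
  | succ r ih =>
    rw [succ_nsmul, ← add_assoc, ← add_assoc] at h
    exact ih (hI.monomial_mem_pow_of_add_single s _ _ h)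

end MonomialIdeal

/-! ### Integral closures of monomial ideals -/

section IntClosure

theorem Ideal.mem_intClosure {R : Type*} [CommRing R] {I : Ideal R} {f : R} :
    f ∈ I.intClosure ↔ IsIntegralOverIdeal I f := Iff.rfl

theorem Ideal.intClosure_mono {R : Type*} [CommRing R] {I J : Ideal R} (h : I ≤ J) :
    I.intClosure ≤ J.intClosure := by
  rintro f ⟨n, hn, r, hr, e⟩
  exact ⟨n, hn, r, fun i hi => Ideal.pow_right_mono h i (hr i hi), e⟩

theorem Ideal.mem_intClosure_of_pow_mem {R : Type*} [CommRing R] {I : Ideal R} {f : R} {n : ℕ}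
    (hn : 0 < n) (h : f ^ n ∈ I ^ n) : f ∈ I.intClosure := by
  refine ⟨n, hn, fun i => if i = n then -f ^ n else 0, fun i _ => ?_, ?_⟩
  · by_cases hi : i = n
    · subst hi; simpa using h
    · simp [hi]
  · rw [Finset.sum_eq_single_of_mem n (by simp; omega)]
    · simp
    · intro i _ hi
      simp [hi]

theorem Ideal.le_intClosure {R : Type*} [CommRing R] (I : Ideal R) : I ≤ I.intClosure :=
  fun f hf => Ideal.mem_intClosure_of_pow_mem one_pos (by simpa using hf)

variable {σ K : Type*} [Field K]

/-- The ring homomorphism `xₛ ↦ xₛ Tₛ` recording the multidegree. -/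
noncomputable def multidegreeHom (σ K : Type*) [Field K] :
    MvPolynomial σ K →+* MvPolynomial σ (MvPolynomial σ K) :=
  eval₂Hom (C.comp C) fun s => C (X s) * X s

theorem multidegreeHom_monomial (a : σ →₀ ℕ) (c : K) :
    multidegreeHom σ K (monomial a c) = monomial a (monomial a c) := by
  have h1 : (a.prod fun s k => C (X s : MvPolynomial σ K) ^ k) =
      (C (monomial a 1) : MvPolynomial σ (MvPolynomial σ K)) := by
    rw [monomial_eq, C_1, one_mul, map_finsuppProd]
    simp
  rw [multidegreeHom, coe_eval₂Hom, eval₂_monomial]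
  simp only [mul_pow, Finsupp.prod_mul, h1, RingHom.comp_apply]
  rw [monomial_eq (a := monomial a c), ← mul_assoc, ← map_mul, C_mul_monomial, mul_one]

theorem coeff_multidegreeHom (f : MvPolynomial σ K) (a : σ →₀ ℕ) :
    (multidegreeHom σ K f).coeff a = monomial a (f.coeff a) := by
  classical
  induction f using MvPolynomial.induction_on' with
  | monomial b c =>
    rw [multidegreeHom_monomial, coeff_monomial, coeff_monomial]
    split_ifs with h
    · rw [h]
    · simp
  | add p q hp hq => simp [hp, hq]

/-- The coefficients of the equation lift to polynomials over A, and integrality over a polynomial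
ring is tested coefficientwise. -/
theorem isIntegral_coeff_of_equation {A S : Type*} [CommRing A] [CommRing S] [Algebra A S]
    {F : MvPolynomial σ S} {n : ℕ} {b : ℕ → MvPolynomial σ S}
    (hb : ∀ i ∈ Finset.Icc 1 n, ∀ c, (b i).coeff c ∈ Set.range (algebraMap A S))
    (e : F ^ n + ∑ i ∈ Finset.Icc 1 n, b i * F ^ (n - i) = 0) (c : σ →₀ ℕ) :
    IsIntegral A (F.coeff c) := by
  have key : ∀ i ∈ Finset.Icc 1 n, ∃ p : MvPolynomial σ A, map (algebraMap A S) p = b i := by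
    intro i hi
    have : b i ∈ Set.range (map (σ := σ) (algebraMap A S)) := by
      rw [mem_range_map_iff_coeffs_subset]
      intro x hx
      obtain ⟨c, -, rfl⟩ := mem_coeffs_iff.1 hx
      exact hb i hi c
    exact this
  choose! p hp using key
  let _ : Algebra (MvPolynomial σ A) (MvPolynomial σ S) := MvPolynomial.algebraMvPolynomial
  refine MvPolynomial.isIntegral_iff_isIntegral_coeff.1 (?_ : IsIntegral (MvPolynomial σ A) F) c
  refine ⟨Polynomial.X ^ n +
    ∑ i ∈ Finset.Icc 1 n, Polynomial.C (p i) * Polynomial.X ^ (n - i), ?_, ?_⟩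
  · refine Polynomial.monic_X_pow_add ?_
    refine lt_of_le_of_lt (Polynomial.degree_sum_le _ _) ?_
    refine (Finset.sup_lt_iff (WithBot.bot_lt_coe n)).2 ?_
    intro i hi
    rw [Finset.mem_Icc] at hi
    refine lt_of_le_of_lt (Polynomial.degree_C_mul_X_pow_le _ _) ?_
    exact Nat.cast_lt.2 (by omega)
  · simp only [Polynomial.eval₂_add, Polynomial.eval₂_pow, Polynomial.eval₂_X,
      Polynomial.eval₂_finsetSum, Polynomial.eval₂_mul, Polynomial.eval₂_C]
    rw [← e]
    congr 1
    refine Finset.sum_congr rfl fun i hi => ?_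
    rw [← hp i hi]
    rfl

/-- Every term of an element integral over a monomial ideal is integral over it. -/
theorem IsMonomialIdeal.monomial_coeff_mem_intClosure {I : Ideal (MvPolynomial σ K)}
    (hI : IsMonomialIdeal I) {f : MvPolynomial σ K} (hf : f ∈ I.intClosure) (a : σ →₀ ℕ) :
    monomial a (f.coeff a) ∈ I.intClosure := by
  obtain ⟨n, hn, r, hr, e⟩ := hf
  rw [Ideal.mem_intClosure, isIntegralOverIdeal_iff]
  have hadj : ∀ i, ∀ g ∈ I ^ i, Polynomial.monomial i g ∈
      Algebra.adjoin (MvPolynomial σ K) {x | ∃ r ∈ I, Polynomial.C r * Polynomial.X = x} := by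
    intro i g hg
    refine Algebra.adjoin_mono ?_ (monomial_mem_adjoin_monomial hg)
    rintro _ ⟨a, ha, rfl⟩
    exact ⟨a, ha, by simp [Polynomial.C_mul_X_eq_monomial]⟩
  set A := Algebra.adjoin (MvPolynomial σ K) {x | ∃ r ∈ I, Polynomial.C r * Polynomial.X = x}
  -- Φ sends f to the sum of its terms, each marked by its multidegree. Multiplied by the Rees
  -- variable, Φ f satisfies an equation whose coefficients lie in the Rees algebra, because each
  -- term of r_i stays in the monomial ideal I^i.
  let Φ : MvPolynomial σ K →+* MvPolynomial σ (Polynomial (MvPolynomial σ K)) :=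
    (map Polynomial.C).comp (multidegreeHom σ K)
  have hΦ : ∀ g a, (Φ g).coeff a = Polynomial.C (monomial a (g.coeff a)) := fun g a => by
    simp [Φ, coeff_map, coeff_multidegreeHom]
  have hF : IsIntegral A ((C Polynomial.X * Φ f).coeff a) := by
    refine isIntegral_coeff_of_equation (n := n) (b := fun i => C (Polynomial.X ^ i) * Φ (r i))
      (fun i hi c => ?_) ?_ a
    · have hmem : monomial c ((r i).coeff c) ∈ I ^ i := by
        by_cases h0 : (r i).coeff c = 0
        · rw [h0, monomial_zero]
          exact Ideal.zero_mem _
        · have := (I ^ i).mul_mem_left (C ((r i).coeff c))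
            (((hI.pow i).mem_iff.1 (hr i hi)) c (mem_support_iff.2 h0))
          rwa [C_mul_monomial, mul_one] at this
      refine ⟨⟨_, hadj i _ hmem⟩, ?_⟩
      rw [coeff_C_mul, hΦ, mul_comm, Polynomial.C_mul_X_pow_eq_monomial]
      rfl
    · have h2 : ∀ i ∈ Finset.Icc 1 n, C (Polynomial.X ^ i) * Φ (r i) *
          (C Polynomial.X * Φ f) ^ (n - i) = C (Polynomial.X ^ n) * Φ (r i * f ^ (n - i)) := by
        intro i hi
        rw [Finset.mem_Icc] at hi
        obtain ⟨m, rfl⟩ := Nat.exists_eq_add_of_le hi.2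
        simp only [Nat.add_sub_cancel_left, map_mul, map_pow]
        ring
      rw [Finset.sum_congr rfl h2, ← Finset.mul_sum, ← map_sum, mul_pow, ← map_pow, ← map_pow,
        ← mul_add, ← map_add, e, map_zero, mul_zero]
  rwa [coeff_C_mul, hΦ, mul_comm] at hF

theorem IsMonomialIdeal.intClosure {I : Ideal (MvPolynomial σ K)} (hI : IsMonomialIdeal I) :
    IsMonomialIdeal I.intClosure := by
  refine isMonomialIdeal_of_forall fun f hf a ha => ?_
  have := I.intClosure.mul_mem_left (C (f.coeff a)⁻¹) (hI.monomial_coeff_mem_intClosure hf a)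
  rwa [C_mul_monomial, inv_mul_cancel₀ (mem_support_iff.1 ha)] at this

/-- In an integral equation for x^a, the term x^(na) must be cancelled by some r_i x^((n-i)a), so
x^(ia) occurs in r_i ∈ I^i. -/
theorem IsMonomialIdeal.monomial_mem_intClosure_iff {I : Ideal (MvPolynomial σ K)}
    (hI : IsMonomialIdeal I) {a : σ →₀ ℕ} :
    monomial a (1 : K) ∈ I.intClosure ↔ ∃ r, 0 < r ∧ monomial (r • a) (1 : K) ∈ I ^ r := by
  classical
  constructor
  · rintro ⟨n, hn, r, hr, e⟩
    have h := congrArg (coeff (n • a)) e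
    rw [coeff_add, coeff_sum, monomial_pow, coeff_monomial, if_pos rfl] at h
    obtain ⟨i, hi, hne⟩ : ∃ i ∈ Finset.Icc 1 n,
        coeff (n • a) (r i * monomial a (1 : K) ^ (n - i)) ≠ 0 := by
      by_contra! hcon
      rw [Finset.sum_eq_zero hcon] at h
      simp at h
    have hri := hr i hi
    rw [Finset.mem_Icc] at hi
    refine ⟨i, by omega, (hI.pow i).mem_iff.1 hri _ (mem_support_iff.2 fun h0 => hne ?_)⟩
    have hna : n • a = i • a + (n - i) • a := by rw [← add_nsmul]; congr 1; omega
    rw [hna, monomial_pow, coeff_mul_monomial, h0, zero_mul]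
  · rintro ⟨r, hr, h⟩
    exact Ideal.mem_intClosure_of_pow_mem hr (by simpa [monomial_pow] using h)

/-- Pass to r-th powers: x^(ra) x_s^r lies in I^(ir+r), and removing r copies of x_s costs at most r
powers of I. -/
theorem IsMonomialIdeal.monomial_mem_intClosure_pow_of_add_single
    {I : Ideal (MvPolynomial σ K)} (hI : IsMonomialIdeal I) (i : ℕ) (a : σ →₀ ℕ) (s : σ)
    (h : monomial (a + Finsupp.single s 1) (1 : K) ∈ (I ^ (i + 1)).intClosure) :
    monomial a (1 : K) ∈ (I ^ i).intClosure := by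
  rw [(hI.pow _).monomial_mem_intClosure_iff] at h ⊢
  obtain ⟨r, hr, h⟩ := h
  refine ⟨r, hr, ?_⟩
  rw [nsmul_add, ← pow_mul, add_mul, one_mul] at h
  rw [← pow_mul]
  exact hI.monomial_mem_pow_of_add_nsmul_single s _ _ _ h

end IntClosure

/-! ### Colons by monomials and the local v-number -/

section LocalVNumber

variable {σ K : Type*} [Field K]

theorem IsMonomialIdeal.colon_monomial {L : Ideal (MvPolynomial σ K)} (hL : IsMonomialIdeal L)
    (a : σ →₀ ℕ) : IsMonomialIdeal (L.colon {monomial a (1 : K)}) := by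
  refine isMonomialIdeal_of_forall fun f hf c hc => ?_
  rw [Submodule.mem_colon_singleton, smul_eq_mul] at hf ⊢
  rw [monomial_mul, mul_one]
  refine hL.mem_iff.1 hf _ (mem_support_iff.2 ?_)
  rw [coeff_mul_monomial, mul_one]
  exact mem_support_iff.1 hc

theorem IsMonomialIdeal.colon_monomial_eq_iff {L P : Ideal (MvPolynomial σ K)}
    (hL : IsMonomialIdeal L) (hP : IsMonomialIdeal P) {a : σ →₀ ℕ} :
    L.colon {monomial a (1 : K)} = P ↔
      ∀ c, monomial (a + c) (1 : K) ∈ L ↔ monomial c (1 : K) ∈ P := by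
  have h : ∀ c, monomial c (1 : K) ∈ L.colon {monomial a (1 : K)} ↔
      monomial (a + c) (1 : K) ∈ L := fun c => by
    rw [Submodule.mem_colon_singleton, smul_eq_mul, monomial_mul, mul_one, add_comm]
  constructor
  · rintro rfl c
    exact (h c).symm
  · exact fun H => (hL.colon_monomial a).ext hP fun c => (h c).trans (H c)

/-- If a monomial prime is `L : f` with `L` monomial, then it is `L : u` for a monomial `u`
of `f`. -/
theorem IsMonomialIdeal.exists_colon_monomial_eq {L P : Ideal (MvPolynomial σ K)}
    (hL : IsMonomialIdeal L) (hP : IsMonomialIdeal P) (hprime : P.IsPrime)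
    {f : MvPolynomial σ K} (hf : L.colon {f} = P) :
    ∃ a ∈ f.support, L.colon {monomial a (1 : K)} = P := by
  -- The colons by the monomials of f intersect inside L : f = P; primality puts one of them inside
  -- P.
  have hle : f.support.inf (fun a => L.colon {monomial a (1 : K)}) ≤ P := by
    intro g hg
    rw [← hf, Submodule.mem_colon_singleton, smul_eq_mul, f.as_sum, Finset.mul_sum]
    refine Ideal.sum_mem _ fun a ha => ?_
    have h1 : g ∈ L.colon {monomial a (1 : K)} := (Finset.inf_le (f := fun a =>
      L.colon {monomial a (1 : K)}) ha) hg
    rw [Submodule.mem_colon_singleton, smul_eq_mul] at h1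
    have h2 := L.mul_mem_left (C (f.coeff a)) h1
    rwa [mul_left_comm, C_mul_monomial, mul_one] at h2
  obtain ⟨a, ha, hap⟩ := (Ideal.IsPrime.inf_le' hprime).1 hle
  -- For the other inclusion, x^c f ∈ L puts every term of x^c f in L.
  refine ⟨a, ha, le_antisymm hap fun g hg => ?_⟩
  rw [(hL.colon_monomial a).mem_iff]
  intro c hc
  have h1 := hP.mem_iff.1 hg c hc
  rw [← hf, Submodule.mem_colon_singleton, smul_eq_mul] at h1
  rw [Submodule.mem_colon_singleton, smul_eq_mul, monomial_mul, mul_one]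
  refine hL.mem_iff.1 h1 _ (mem_support_iff.2 ?_)
  rw [coeff_monomial_mul, one_mul]
  exact mem_support_iff.1 ha

theorem mem_associatedPrimes_quotient_iff {R : Type*} [CommRing R] [IsNoetherianRing R]
    {L P : Ideal R} : P ∈ associatedPrimes R (R ⧸ L) ↔ P.IsPrime ∧ ∃ f, L.colon {f} = P := by
  have h : ∀ f : R, (⊥ : Submodule R (R ⧸ L)).colon {Ideal.Quotient.mk L f} = L.colon {f} := by
    intro f
    ext r
    rw [Submodule.mem_colon_singleton, Submodule.mem_colon_singleton, Submodule.mem_bot,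
      smul_eq_mul, Algebra.smul_def, Ideal.Quotient.algebraMap_eq, ← map_mul,
      Ideal.Quotient.eq_zero_iff_mem]
  rw [AssociatedPrimes.mem_iff, isAssociatedPrime_iff]
  refine and_congr_right fun _ => ⟨?_, ?_⟩
  · rintro ⟨x, hx⟩
    obtain ⟨f, rfl⟩ := Ideal.Quotient.mk_surjective x
    exact ⟨f, by rw [hx, h]⟩
  · rintro ⟨f, hf⟩
    exact ⟨Ideal.Quotient.mk L f, by rw [h, hf]⟩

theorem localVNumber_le_degree {L P : Ideal (MvPolynomial σ K)} {a : σ →₀ ℕ}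
    (h : L.colon {monomial a (1 : K)} = P) : localVNumber L P ≤ (a.degree : ℕ∞) :=
  iInf₂_le (f := fun (d : ℕ) (_ : ∃ f : MvPolynomial σ K, f.IsHomogeneous d ∧ L.colon {f} = P) =>
    (d : ℕ∞)) a.degree ⟨_, isHomogeneous_monomial _ rfl, h⟩

/-- The local `v`-number of a monomial ideal at a monomial associated prime is attained by a
monomial. -/
theorem IsMonomialIdeal.exists_localVNumber_eq [Finite σ] {L P : Ideal (MvPolynomial σ K)}
    (hL : IsMonomialIdeal L) (hP : IsMonomialIdeal P)
    (h : P ∈ associatedPrimes (MvPolynomial σ K) (MvPolynomial σ K ⧸ L)) :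
    ∃ a : σ →₀ ℕ, L.colon {monomial a (1 : K)} = P ∧ localVNumber L P = (a.degree : ℕ∞) := by
  classical
  obtain ⟨hprime, f, hf⟩ := mem_associatedPrimes_quotient_iff.1 h
  have hex : ∃ d : ℕ, ∃ f : MvPolynomial σ K, f.IsHomogeneous d ∧ L.colon {f} = P := by
    obtain ⟨a, -, ha⟩ := hL.exists_colon_monomial_eq hP hprime hf
    exact ⟨_, _, isHomogeneous_monomial _ rfl, ha⟩
  obtain ⟨g, hg, hgP⟩ := Nat.find_spec hex
  -- As g is homogeneous, replacing it by one of its monomials keeps the minimal degree.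
  obtain ⟨a, ha, haP⟩ := hL.exists_colon_monomial_eq hP hprime hgP
  have hdeg : a.degree = Nat.find hex := by
    rw [Finsupp.degree_eq_weight_one]
    exact hg (mem_support_iff.1 ha)
  refine ⟨a, haP, le_antisymm (localVNumber_le_degree haP) (le_iInf₂ fun d hd => ?_)⟩
  rw [hdeg]
  exact_mod_cast Nat.find_min' hex hd

theorem IsMonomialIdeal.exists_X_mem {P : Ideal (MvPolynomial σ K)} (hP : IsMonomialIdeal P)
    (hprime : P.IsPrime) (h0 : P ≠ ⊥) : ∃ s, monomial (Finsupp.single s 1) (1 : K) ∈ P := by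
  obtain ⟨f, hf, hf0⟩ := Submodule.exists_mem_ne_zero_of_ne_bot h0
  obtain ⟨a, ha⟩ := Finset.nonempty_iff_ne_empty.2 (mt support_eq_empty.1 hf0)
  have h1 := hP.mem_iff.1 hf a ha
  rw [monomial_eq, C_1, one_mul, Finsupp.prod, hprime.prod_mem_iff] at h1
  obtain ⟨s, -, hs⟩ := h1
  exact ⟨s, hprime.mem_of_pow_mem _ hs⟩

end LocalVNumber

/-! ### Extended ideals in the joint polynomial ring -/

section Sum

variable {K : Type*} [Field K] {n m : ℕ}

theorem exists_eq_sumElim {α β : Type*} (c : α ⊕ β →₀ ℕ) :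
    ∃ a b, c = Finsupp.sumElim a b :=
  ⟨_, _, (Finsupp.comapDomain_sumElim_comapDomain c).symm⟩

theorem sumElim_le_sumElim {α β : Type*} {a a' : α →₀ ℕ} {b b' : β →₀ ℕ} :
    Finsupp.sumElim a b ≤ Finsupp.sumElim a' b' ↔ a ≤ a' ∧ b ≤ b' := by
  simp only [Finsupp.le_def, Sum.forall, Finsupp.sumElim_inl, Finsupp.sumElim_inr]

theorem sumElim_inj {α β : Type*} {a a' : α →₀ ℕ} {b b' : β →₀ ℕ} :
    Finsupp.sumElim a b = Finsupp.sumElim a' b' ↔ a = a' ∧ b = b' := by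
  simp only [Finsupp.ext_iff, Sum.forall, Finsupp.sumElim_inl, Finsupp.sumElim_inr]

theorem degree_sumElim (a : Fin n →₀ ℕ) (b : Fin m →₀ ℕ) :
    (Finsupp.sumElim a b).degree = a.degree + b.degree := by
  simp [Finsupp.degree_eq_sum]

theorem IsMonomialIdeal.extendLeft_and {I : Ideal (MvPolynomial (Fin n) K)}
    (hI : IsMonomialIdeal I) (m : ℕ) : IsMonomialIdeal (extendLeft m I) ∧
    ∀ (a : Fin n →₀ ℕ) (b : Fin m →₀ ℕ),
      monomial (Finsupp.sumElim a b) (1 : K) ∈ extendLeft m I ↔ monomial a (1 : K) ∈ I := by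
  obtain ⟨T, rfl⟩ := hI
  have h : extendLeft m (Ideal.span ((fun c => monomial c (1 : K)) '' T)) =
      Ideal.span ((fun c => monomial c (1 : K)) ''
        ((fun t => Finsupp.sumElim t (0 : Fin m →₀ ℕ)) '' T)) := by
    rw [extendLeft, Ideal.map_span, Set.image_image, Set.image_image]
    congr 1
    refine Set.image_congr fun t _ => ?_
    rw [Finsupp.sumElim_eq_add, Finsupp.mapDomain_zero, add_zero]
    exact rename_monomial _ _ _
  refine ⟨⟨_, h⟩, fun a b => ?_⟩
  rw [h, monomial_mem_span_iff, monomial_mem_span_iff]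
  simp [sumElim_le_sumElim]

theorem IsMonomialIdeal.extendRight_and {J : Ideal (MvPolynomial (Fin m) K)}
    (hJ : IsMonomialIdeal J) (n : ℕ) : IsMonomialIdeal (extendRight n J) ∧
    ∀ (a : Fin n →₀ ℕ) (b : Fin m →₀ ℕ),
      monomial (Finsupp.sumElim a b) (1 : K) ∈ extendRight n J ↔ monomial b (1 : K) ∈ J := by
  obtain ⟨T, rfl⟩ := hJ
  have h : extendRight n (Ideal.span ((fun c => monomial c (1 : K)) '' T)) =
      Ideal.span ((fun c => monomial c (1 : K)) ''
        ((fun t => Finsupp.sumElim (0 : Fin n →₀ ℕ) t) '' T)) := by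
    rw [extendRight, Ideal.map_span, Set.image_image, Set.image_image]
    congr 1
    refine Set.image_congr fun t _ => ?_
    rw [Finsupp.sumElim_eq_add, Finsupp.mapDomain_zero, zero_add]
    exact rename_monomial _ _ _
  refine ⟨⟨_, h⟩, fun a b => ?_⟩
  rw [h, monomial_mem_span_iff, monomial_mem_span_iff]
  simp [sumElim_le_sumElim]

theorem IsMonomialIdeal.extend_add_and {I : Ideal (MvPolynomial (Fin n) K)}
    {J : Ideal (MvPolynomial (Fin m) K)} (hI : IsMonomialIdeal I) (hJ : IsMonomialIdeal J) :
    IsMonomialIdeal (extendLeft m I + extendRight n J) ∧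
    ∀ (a : Fin n →₀ ℕ) (b : Fin m →₀ ℕ),
      monomial (Finsupp.sumElim a b) (1 : K) ∈ extendLeft m I + extendRight n J ↔
        monomial a (1 : K) ∈ I ∨ monomial b (1 : K) ∈ J := by
  have h := (hI.extendLeft_and m).1.sup_and (hJ.extendRight_and n).1
  refine ⟨h.1, fun a b => ?_⟩
  rw [h.2, (hI.extendLeft_and m).2, (hJ.extendRight_and n).2]

theorem IsMonomialIdeal.extend_mul_and {I : Ideal (MvPolynomial (Fin n) K)}
    {J : Ideal (MvPolynomial (Fin m) K)} (hI : IsMonomialIdeal I) (hJ : IsMonomialIdeal J) :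
    IsMonomialIdeal (extendLeft m I * extendRight n J) ∧
    ∀ (a : Fin n →₀ ℕ) (b : Fin m →₀ ℕ),
      monomial (Finsupp.sumElim a b) (1 : K) ∈ extendLeft m I * extendRight n J ↔
        monomial a (1 : K) ∈ I ∧ monomial b (1 : K) ∈ J := by
  obtain ⟨hI', hI''⟩ := hI.extendLeft_and m
  obtain ⟨hJ', hJ''⟩ := hJ.extendRight_and n
  have h := hI'.mul_and hJ'
  refine ⟨h.1, fun a b => ?_⟩
  rw [h.2]
  constructor
  · rintro ⟨c, d, e, hc, hd⟩
    obtain ⟨a₁, b₁, rfl⟩ := exists_eq_sumElim c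
    obtain ⟨a₂, b₂, rfl⟩ := exists_eq_sumElim d
    rw [← Finsupp.sumElim_add, sumElim_inj] at e
    obtain ⟨rfl, rfl⟩ := e
    rw [hI''] at hc
    rw [hJ''] at hd
    exact ⟨monomial_mem_of_le le_self_add hc, monomial_mem_of_le le_add_self hd⟩
  · rintro ⟨ha, hb⟩
    exact ⟨Finsupp.sumElim a 0, Finsupp.sumElim 0 b, by simp [← Finsupp.sumElim_add],
      (hI'' _ _).2 ha, (hJ'' _ _).2 hb⟩

end Sum

/-! ### Combinatorial core: two filtrations of exponents -/

section Exponents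

variable {σ τ : Type*} {E : ℕ → Set (σ →₀ ℕ)} {F : ℕ → Set (τ →₀ ℕ)}
  {U : Set (σ →₀ ℕ)} {V : Set (τ →₀ ℕ)} {a : σ →₀ ℕ} {b : τ →₀ ℕ} {k : ℕ}

/-- The index d is the last step of F containing b. `hUV` asks for a variable on one side only,
since p + q ≠ 0 gives no more in advance. -/
theorem exists_index_of_sum_colon (hE : Antitone E) (hF : Antitone F)
    (hE0 : E 0 = Set.univ) (hF0 : F 0 = Set.univ)
    (hEs : ∀ i a s, a + Finsupp.single s 1 ∈ E (i + 1) → a ∈ E i)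
    (hFs : ∀ i b t, b + Finsupp.single t 1 ∈ F (i + 1) → b ∈ F i)
    (hU : 0 ∉ U) (hV : 0 ∉ V)
    (hUV : (∃ s, Finsupp.single s 1 ∈ U) ∨ ∃ t, Finsupp.single t 1 ∈ V)
    (h : ∀ c e, (∃ i j, i + j = k ∧ a + c ∈ E i ∧ b + e ∈ F j) ↔ c ∈ U ∨ e ∈ V) :
    ∃ d < k, (∀ c, a + c ∈ E (k - d) ↔ c ∈ U) ∧ ∀ e, b + e ∈ F (d + 1) ↔ e ∈ V := by
  classical
  have h0 : ∀ i j, i + j = k → a ∈ E i → b ∉ F j := fun i j hij hi hj =>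
    not_or.2 ⟨hU, hV⟩ ((h 0 0).1 ⟨i, j, hij, by simpa using hi, by simpa using hj⟩)
  have hUi : ∀ c, (∃ i j, i + j = k ∧ a + c ∈ E i ∧ b ∈ F j) ↔ c ∈ U := fun c => by
    simpa [hV] using h c 0
  have hVi : ∀ e, (∃ i j, i + j = k ∧ a ∈ E i ∧ b + e ∈ F j) ↔ e ∈ V := fun e => by
    simpa [hU] using h 0 e
  set d := Nat.findGreatest (fun j => b ∈ F j) k with hd
  have hbd : b ∈ F d := Nat.findGreatest_spec (P := fun j => b ∈ F j) (Nat.zero_le k)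
    (by simp [hF0])
  have hmax : ∀ j ≤ k, b ∈ F j → j ≤ d := fun j hj hb => Nat.le_findGreatest hj hb
  have hdk : d ≤ k := Nat.findGreatest_le k
  have hnd : a ∉ E (k - d) := fun ha => h0 (k - d) d (by omega) ha hbd
  have hlow : ∀ i, a ∈ E i → i < k - d := fun i hi => by
    by_contra! hlt
    exact hnd (hE hlt hi)
  have hU' : ∀ c, a + c ∈ E (k - d) ↔ c ∈ U := by
    refine fun c => ⟨fun hc => (hUi c).1 ⟨k - d, d, by omega, hc, hbd⟩, fun hc => ?_⟩
    obtain ⟨i, j, hij, hi, hj⟩ := (hUi c).2 hc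
    have := hmax j (by omega) hj
    exact hE (by omega) hi
  -- E_0 contains every exponent, so a ∈ E_0 forces 0 < k - d.
  have hd_lt : d < k := by
    have := hlow 0 (by simp [hE0])
    omega
  have haE : a ∈ E (k - d - 1) := by
    rcases hUV with ⟨s, hs⟩ | ⟨t, ht⟩
    · have h1 := (hU' _).2 hs
      refine hEs _ _ s ?_
      rwa [show k - d - 1 + 1 = k - d by omega]
    -- Here i < k - d, while removing the variable from b + e_t gives j ≤ d + 1; hence i = k - d -
    -- 1.
    · obtain ⟨i, j, hij, hi, hj⟩ := (hVi _).2 ht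
      have h1 := hlow i hi
      obtain ⟨j, rfl⟩ : ∃ j', j = j' + 1 := ⟨j - 1, by omega⟩
      have h2 := hmax j (by omega) (hFs _ _ _ hj)
      rwa [show k - d - 1 = i by omega]
  refine ⟨d, hd_lt, hU', fun e => ⟨fun he => (hVi e).1 ⟨k - d - 1, d + 1, by omega, haE, he⟩,
    fun he => ?_⟩⟩
  obtain ⟨i, j, hij, hi, hj⟩ := (hVi e).2 he
  have := hlow i hi
  exact hF (by omega) hj

/-- A variable in V gives b ∈ F d, and one in U gives a ∈ E (k - d - 1); so variables are needed on
both sides. Any i + j = k has i ≥ k - d or j ≥ d + 1. -/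
theorem sum_colon_of_index (hE : Antitone E) (hF : Antitone F)
    (hEs : ∀ i a s, a + Finsupp.single s 1 ∈ E (i + 1) → a ∈ E i)
    (hFs : ∀ i b t, b + Finsupp.single t 1 ∈ F (i + 1) → b ∈ F i)
    (hEa : ∀ i a c, a ∈ E i → a + c ∈ E i) (hFa : ∀ i b e, b ∈ F i → b + e ∈ F i)
    (hU : ∃ s, Finsupp.single s 1 ∈ U) (hV : ∃ t, Finsupp.single t 1 ∈ V) {d : ℕ} (hd : d < k)
    (ha : ∀ c, a + c ∈ E (k - d) ↔ c ∈ U) (hb : ∀ e, b + e ∈ F (d + 1) ↔ e ∈ V)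
    (c : σ →₀ ℕ) (e : τ →₀ ℕ) :
    (∃ i j, i + j = k ∧ a + c ∈ E i ∧ b + e ∈ F j) ↔ c ∈ U ∨ e ∈ V := by
  obtain ⟨s, hs⟩ := hU
  obtain ⟨t, ht⟩ := hV
  constructor
  · rintro ⟨i, j, hij, hi, hj⟩
    by_cases hid : k - d ≤ i
    · exact Or.inl ((ha c).1 (hE hid hi))
    · exact Or.inr ((hb e).1 (hF (by omega) hj))
  · rintro (hc | he)
    · exact ⟨k - d, d, by omega, (ha c).2 hc, hFa _ _ _ (hFs _ _ t ((hb _).2 ht))⟩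
    · refine ⟨k - d - 1, d + 1, by omega, hEa _ _ _ (hEs _ _ s ?_), (hb e).2 he⟩
      rw [show k - d - 1 + 1 = k - d by omega]
      exact (ha _).2 hs

end Exponents

/-! ### The binomial sum of integral closures in terms of exponents -/

section BinomialSum

variable {K : Type*} [Field K] {n m : ℕ}

/-- The exponents of the monomials in the integral closure of `I ^ i`. -/
def closureExponents {σ : Type*} (I : Ideal (MvPolynomial σ K)) (i : ℕ) : Set (σ →₀ ℕ) :=
  {a | monomial a (1 : K) ∈ (I ^ i).intClosure}

theorem closureExponents_antitone {σ : Type*} (I : Ideal (MvPolynomial σ K)) :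
    Antitone (closureExponents I) :=
  fun _ _ hij _ ha => Ideal.intClosure_mono (Ideal.pow_le_pow_right hij) ha

theorem closureExponents_zero {σ : Type*} (I : Ideal (MvPolynomial σ K)) :
    closureExponents I 0 = Set.univ :=
  Set.eq_univ_of_forall fun _ => Ideal.le_intClosure _ (by simp)

theorem closureExponents_add {σ : Type*} (I : Ideal (MvPolynomial σ K)) (i : ℕ) (a c : σ →₀ ℕ)
    (ha : a ∈ closureExponents I i) : a + c ∈ closureExponents I i := by
  rw [closureExponents, Set.mem_ofPred_eq] at ha ⊢
  exact monomial_mem_of_le le_self_add ha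

theorem IsMonomialIdeal.sum_intClosure_and {I : Ideal (MvPolynomial (Fin n) K)}
    {J : Ideal (MvPolynomial (Fin m) K)} (hI : IsMonomialIdeal I) (hJ : IsMonomialIdeal J)
    (k : ℕ) :
    IsMonomialIdeal (∑ ij ∈ Finset.HasAntidiagonal.antidiagonal k,
      extendLeft m (I ^ ij.1).intClosure * extendRight n (J ^ ij.2).intClosure) ∧
    ∀ (a : Fin n →₀ ℕ) (b : Fin m →₀ ℕ), monomial (Finsupp.sumElim a b) (1 : K) ∈
      ∑ ij ∈ Finset.HasAntidiagonal.antidiagonal k,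
        extendLeft m (I ^ ij.1).intClosure * extendRight n (J ^ ij.2).intClosure ↔
      ∃ i j, i + j = k ∧ a ∈ closureExponents I i ∧ b ∈ closureExponents J j := by
  have h : ∀ i j, _ := fun i j =>
    (hI.pow i).intClosure.extend_mul_and (n := n) (m := m) (hJ.pow j).intClosure
  have hs := IsMonomialIdeal.sum_and (Finset.HasAntidiagonal.antidiagonal k)
    (fun ij => extendLeft m (I ^ ij.1).intClosure * extendRight n (J ^ ij.2).intClosure)
    fun ij _ => (h ij.1 ij.2).1
  refine ⟨hs.1, fun a b => ?_⟩
  rw [hs.2, Prod.exists]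
  refine exists₂_congr fun i j => ?_
  rw [Finset.HasAntidiagonal.mem_antidiagonal, (h i j).2]
  rfl

/-- P is a colon of L, hence contains L. -/
theorem ne_bot_of_mem_associatedPrimes_quotient {R : Type*} [CommRing R] [IsNoetherianRing R]
    {L P : Ideal R} (hL : L ≠ ⊥) (h : P ∈ associatedPrimes R (R ⧸ L)) : P ≠ ⊥ := by
  obtain ⟨-, f, rfl⟩ := mem_associatedPrimes_quotient_iff.1 h
  refine fun h0 => hL (eq_bot_iff.2 (le_trans (fun g hg => ?_) h0.le))
  rw [Submodule.mem_colon_singleton, smul_eq_mul]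
  exact L.mul_mem_right f hg

theorem pow_intClosure_ne_bot {R : Type*} [CommRing R] [IsDomain R] {I : Ideal R} (hI : I ≠ ⊥)
    (i : ℕ) : (I ^ i).intClosure ≠ ⊥ := by
  refine ne_bot_of_le_ne_bot ?_ (Ideal.le_intClosure _)
  exact pow_ne_zero i hI

/-- The equality `L : xᵃyᵇ = 𝔭 + 𝔮`, for `L` the sum of the products of the integral closures, in
terms of exponents. -/
theorem colon_sumElim_iff {I : Ideal (MvPolynomial (Fin n) K)}
    {J : Ideal (MvPolynomial (Fin m) K)} {L : Ideal (MvPolynomial (Fin n ⊕ Fin m) K)} {k : ℕ}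
    (hI : IsMonomialIdeal I) (hJ : IsMonomialIdeal J)
    (hL : L = ∑ ij ∈ Finset.HasAntidiagonal.antidiagonal k,
      extendLeft m (I ^ ij.1).intClosure * extendRight n (J ^ ij.2).intClosure)
    {p : Ideal (MvPolynomial (Fin n) K)} {q : Ideal (MvPolynomial (Fin m) K)}
    (hpm : IsMonomialIdeal p) (hqm : IsMonomialIdeal q) {a : Fin n →₀ ℕ} {b : Fin m →₀ ℕ} :
    L.colon {monomial (Finsupp.sumElim a b) (1 : K)} = extendLeft m p + extendRight n q ↔
      ∀ c e, (∃ i j, i + j = k ∧ a + c ∈ closureExponents I i ∧ b + e ∈ closureExponents J j) ↔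
        c ∈ {c | monomial c (1 : K) ∈ p} ∨ e ∈ {e | monomial e (1 : K) ∈ q} := by
  subst hL
  have hs := hI.sum_intClosure_and hJ k
  have hP := hpm.extend_add_and hqm
  rw [hs.1.colon_monomial_eq_iff hP.1]
  refine ⟨fun h c e => ?_, fun h c => ?_⟩
  · rw [← hs.2, Finsupp.sumElim_add, h, hP.2]
    rfl
  · obtain ⟨c, e, rfl⟩ := exists_eq_sumElim c
    rw [← Finsupp.sumElim_add, hs.2, h, hP.2]
    rfl

end BinomialSum

/-! ### The formula for the local v-number -/

theorem corollary2p7 {K : Type*} [Field K] (n m k : ℕ)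
    (I : Ideal (MvPolynomial (Fin n) K)) (J : Ideal (MvPolynomial (Fin m) K))
    (hI : IsMonomialIdeal I) (hJ : IsMonomialIdeal J) (hI0 : I ≠ ⊥) (hJ0 : J ≠ ⊥)
    (hbin : ((extendLeft m I + extendRight n J) ^ k).intClosure =
      ∑ ij ∈ Finset.HasAntidiagonal.antidiagonal k,
        extendLeft m (I ^ ij.1).intClosure * extendRight n (J ^ ij.2).intClosure)
    (p : Ideal (MvPolynomial (Fin n) K)) (q : Ideal (MvPolynomial (Fin m) K))
    (hp : p.IsPrime) (hpm : IsMonomialIdeal p) (hq : q.IsPrime) (hqm : IsMonomialIdeal q)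
    (hpq : extendLeft m p + extendRight n q ∈
      associatedPrimes (MvPolynomial (Fin n ⊕ Fin m) K)
        (MvPolynomial (Fin n ⊕ Fin m) K ⧸ ((extendLeft m I + extendRight n J) ^ k).intClosure)) :
    localVNumber ((extendLeft m I + extendRight n J) ^ k).intClosure
        (extendLeft m p + extendRight n q) ≠ ⊤ ∧
    IsLeast
      {v : ℕ∞ | ∃ d < k,
        p ∈ associatedPrimes (MvPolynomial (Fin n) K)
          (MvPolynomial (Fin n) K ⧸ (I ^ (k - d)).intClosure) ∧
        q ∈ associatedPrimes (MvPolynomial (Fin m) K)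
          (MvPolynomial (Fin m) K ⧸ (J ^ (d + 1)).intClosure) ∧
        v = localVNumber (I ^ (k - d)).intClosure p + localVNumber (J ^ (d + 1)).intClosure q}
      (localVNumber ((extendLeft m I + extendRight n J) ^ k).intClosure
        (extendLeft m p + extendRight n q)) := by
  have hL := hI.sum_intClosure_and hJ k
  rw [← hbin] at hL
  have hL0 : ((extendLeft m I + extendRight n J) ^ k).intClosure ≠ ⊥ := by
    refine pow_intClosure_ne_bot (ne_bot_of_le_ne_bot (b := extendLeft m I) ?_ ?_) k
    · exact (Ideal.map_eq_bot_iff_of_injective (rename_injective _ Sum.inl_injective)).not.2 hI0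
    · rw [Submodule.add_eq_sup]
      exact le_sup_left
  have hP := hpm.extend_add_and hqm
  have h0 : ∀ {σ : Type} {P : Ideal (MvPolynomial σ K)}, P.IsPrime →
      (0 : σ →₀ ℕ) ∉ {c | monomial c (1 : K) ∈ P} := fun hP h =>
    hP.ne_top ((Ideal.eq_top_iff_one _).2 h)
  have hEs := fun i a s => hI.monomial_mem_intClosure_pow_of_add_single i a s
  have hFs := fun i b t => hJ.monomial_mem_intClosure_pow_of_add_single i b t
  obtain ⟨u, hu, hdeg⟩ := hL.1.exists_localVNumber_eq hP.1 hpq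
  obtain ⟨a, b, rfl⟩ := exists_eq_sumElim u
  have hlower : ∀ d < k,
      p ∈ associatedPrimes (MvPolynomial (Fin n) K)
        (MvPolynomial (Fin n) K ⧸ (I ^ (k - d)).intClosure) →
      q ∈ associatedPrimes (MvPolynomial (Fin m) K)
        (MvPolynomial (Fin m) K ⧸ (J ^ (d + 1)).intClosure) →
      localVNumber ((extendLeft m I + extendRight n J) ^ k).intClosure
        (extendLeft m p + extendRight n q) ≤
      localVNumber (I ^ (k - d)).intClosure p + localVNumber (J ^ (d + 1)).intClosure q := by
    intro d hd hpd hqd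
    have hI' := (hI.pow (k - d)).intClosure
    have hJ' := (hJ.pow (d + 1)).intClosure
    obtain ⟨a', ha', hda⟩ := hI'.exists_localVNumber_eq hpm hpd
    obtain ⟨b', hb', hdb⟩ := hJ'.exists_localVNumber_eq hqm hqd
    rw [hda, hdb, ← Nat.cast_add, ← degree_sumElim]
    refine localVNumber_le_degree ((colon_sumElim_iff hI hJ hbin hpm hqm).2 ?_)
    exact sum_colon_of_index (closureExponents_antitone I) (closureExponents_antitone J) hEs hFs
      (closureExponents_add I) (closureExponents_add J)
      (hpm.exists_X_mem hp (ne_bot_of_mem_associatedPrimes_quotient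
        (pow_intClosure_ne_bot hI0 _) hpd))
      (hqm.exists_X_mem hq (ne_bot_of_mem_associatedPrimes_quotient
        (pow_intClosure_ne_bot hJ0 _) hqd)) hd
      ((hI'.colon_monomial_eq_iff hpm).1 ha') ((hJ'.colon_monomial_eq_iff hqm).1 hb')
  have hUV : p ≠ ⊥ ∨ q ≠ ⊥ := by
    by_contra! hcon
    refine ne_bot_of_mem_associatedPrimes_quotient hL0 hpq ?_
    rw [hcon.1, hcon.2, extendLeft, extendRight, Ideal.map_bot, Ideal.map_bot, Submodule.add_eq_sup,
      sup_idem]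
  obtain ⟨d, hd, hda, hdb⟩ := exists_index_of_sum_colon (closureExponents_antitone I)
    (closureExponents_antitone J) (closureExponents_zero I) (closureExponents_zero J) hEs hFs
    (h0 hp) (h0 hq) (hUV.imp (hpm.exists_X_mem hp) (hqm.exists_X_mem hq))
    ((colon_sumElim_iff hI hJ hbin hpm hqm).1 hu)
  have ha := ((hI.pow (k - d)).intClosure.colon_monomial_eq_iff hpm).2 hda
  have hb := ((hJ.pow (d + 1)).intClosure.colon_monomial_eq_iff hqm).2 hdb
  have hpd := mem_associatedPrimes_quotient_iff.2 ⟨hp, _, ha⟩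
  have hqd := mem_associatedPrimes_quotient_iff.2 ⟨hq, _, hb⟩
  -- The minimizing monomial x^a y^b splits into x^a and y^b, which bound the two v-numbers by their
  -- degrees; so this d attains the minimum.
  refine ⟨hdeg ▸ ENat.natCast_ne_top _, ⟨d, hd, hpd, hqd, (hlower d hd hpd hqd).antisymm ?_⟩, ?_⟩
  · rw [hdeg, degree_sumElim, Nat.cast_add]
    exact add_le_add (localVNumber_le_degree ha) (localVNumber_le_degree hb)
  · rintro _ ⟨d', hd', hpd', hqd', rfl⟩
    exact hlower d' hd' hpd' hqd'
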